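/- Let $R$ be a commutative Noetherian local ring with residue field $k$, and let $R\ltimes k$ be the idealization of $k$, that is, the commutative ring with underlying abelian group $R\oplus k$, identity $(1,0)$ and multiplication $(r,a)(s,b)=(rs,\,rb+sa)$. Let $M$ be a finitely generated $R\ltimes k$-module. If $$\operatorname{Ext}^{i}_{R\ltimes k}\bigl(M,\,M\oplus (R\ltimes k)\bigr)=0$$ for some integer $i\ge 3$, then $M$ is a free $R\ltimes k$-module. -/

import Mathlib

universe u

/-- The right action of a commutative local ring `R` on its residue field `k`, equal to the usual
left action: `op r • x = r • x`. Mathlib's `TrivSqZeroExt R k` asks for a right action. -/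
noncomputable instance residueFieldOpModule (R : Type u) [CommRing R] [IsLocalRing R] :
    Module Rᵐᵒᵖ (IsLocalRing.ResidueField R) :=
  Module.compHom (IsLocalRing.ResidueField R)
    ((RingHom.id R).fromOpposite fun _ _ => Commute.all _ _)

instance residueFieldIsCentralScalar (R : Type u) [CommRing R] [IsLocalRing R] :
    IsCentralScalar R (IsLocalRing.ResidueField R) :=
  ⟨fun _ _ => rfl⟩

/-- The idealization `R ⋉ k` of the residue field `k` of a local ring `R`: the abelian group
`R ⊕ k` with the multiplication `(r, a) * (s, b) = (r * s, r • b + s • a)` and unit `(1, 0)`. -/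
abbrev ResidueIdealization (R : Type u) [CommRing R] [IsLocalRing R] : Type u :=
  TrivSqZeroExt R (IsLocalRing.ResidueField R)

/-!
Write `S = R ⋉ k`, with maximal ideal `𝔫`. The element `e = (0, 1)` is killed by `𝔫`, and
`S e ≅ k` is a direct summand of `𝔫`, the complement being the maximal ideal of `R`. The proof
uses nothing else about `S`, and is written for a Noetherian local ring `S` with a surjection
`π : S → k` whose kernel is `𝔫`, and maps `ι : k → 𝔫`, `ρ : 𝔫 → k` with `ρ ∘ ι = id`.

* If a finitely generated module `M` is not free, then `k` is a direct summand of its second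
  syzygy: for a minimal presentation `F₁ → F₀ → M` the submodule `e F₁` lies in the kernel of
  `F₁ → F₀` because the image of this map is in `𝔫 F₀`, and the kernel lies in `𝔫 F₁`, of which
  `e F₁` is a direct summand (`subsingleton_ext_residue`). So `Extⁱ(M, X) = 0` with `i ≥ 3` gives
  `Extʲ(k, X) = 0` with `j = i - 2 ≥ 1`.
* Since `k` is a direct summand of its own first syzygy `𝔫`, the vanishing of `Extʲ(k, X)`
  descends to `Ext¹(k, X) = 0` (`subsingleton_ext_one`): every linear map `𝔫 → X` extends to `S`.
* For `X = S`, extending the projection `𝔫 → S e ⊆ S` shows `𝔫 = S e`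
  (`ker_le_range_of_extends`). For `X = M`, it follows that an element of `M` killed by `e` lies in
  `e M`, which forces a minimal free cover of `M` to be injective (`injective_of_extends`).
-/

open CategoryTheory CategoryTheory.Abelian IsLocalRing

/-! ### Ext groups of modules -/

section Ext

variable {S : Type u} [CommRing S]

lemma subsingleton_ext_of_retract_left {A B X : Type u} [AddCommGroup A] [Module S A]
    [AddCommGroup B] [Module S B] [AddCommGroup X] [Module S X] (f : A →ₗ[S] B) (g : B →ₗ[S] A)
    (hgf : g ∘ₗ f = LinearMap.id) {j : ℕ}
    (h : Subsingleton (Ext (ModuleCat.of S B) (ModuleCat.of S X) j)) :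
    Subsingleton (Ext (ModuleCat.of S A) (ModuleCat.of S X) j) := by
  refine subsingleton_of_forall_eq 0 fun x => ?_
  have hid : ModuleCat.ofHom f ≫ ModuleCat.ofHom g = 𝟙 (ModuleCat.of S A) := by
    rw [← ModuleCat.ofHom_comp, hgf, ModuleCat.ofHom_id]
  rw [← Ext.mk₀_id_comp x, ← hid, ← Ext.mk₀_comp_mk₀_assoc,
    h.elim ((Ext.mk₀ (ModuleCat.ofHom g)).comp x (zero_add j)) 0, Ext.comp_zero]

lemma subsingleton_ext_of_retract_right {A B X : Type u} [AddCommGroup A] [Module S A]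
    [AddCommGroup B] [Module S B] [AddCommGroup X] [Module S X] (f : A →ₗ[S] B) (g : B →ₗ[S] A)
    (hgf : g ∘ₗ f = LinearMap.id) {j : ℕ}
    (h : Subsingleton (Ext (ModuleCat.of S X) (ModuleCat.of S B) j)) :
    Subsingleton (Ext (ModuleCat.of S X) (ModuleCat.of S A) j) := by
  refine subsingleton_of_forall_eq 0 fun x => ?_
  have hid : ModuleCat.ofHom f ≫ ModuleCat.ofHom g = 𝟙 (ModuleCat.of S A) := by
    rw [← ModuleCat.ofHom_comp, hgf, ModuleCat.ofHom_id]
  rw [← Ext.comp_mk₀_id x, ← hid, ← Ext.mk₀_comp_mk₀,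
    ← Ext.comp_assoc_of_third_deg_zero x (Ext.mk₀ (ModuleCat.ofHom f)) _ (add_zero j),
    h.elim (x.comp (Ext.mk₀ (ModuleCat.ofHom f)) (add_zero j)) 0, Ext.zero_comp]

variable {P C X : Type u} [AddCommGroup P] [Module S P] [AddCommGroup C] [Module S C]
  [AddCommGroup X] [Module S X]

/-- Dimension shifting: a connecting map `Extʲ⁺¹(ker p, X) → Extʲ⁺²(C, X)` is injective. -/
lemma subsingleton_ext_ker [Module.Projective S P] {p : P →ₗ[S] C} (hp : Function.Surjective p)
    {j : ℕ} (h : Subsingleton (Ext (ModuleCat.of S C) (ModuleCat.of S X) (j + 2))) :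
    Subsingleton (Ext (ModuleCat.of S p.ker) (ModuleCat.of S X) (j + 1)) := by
  have hS := LinearMap.shortExact_shortComplexKer hp
  have : Projective (ModuleCat.of S P) := ModuleCat.projective_of_categoryTheory_projective _
  refine subsingleton_of_forall_eq 0 fun x => ?_
  obtain ⟨y, rfl⟩ := Ext.contravariant_sequence_exact₁ hS (ModuleCat.of S X) x
    (show 1 + (j + 1) = j + 2 by lia) (h.elim _ _)
  rw [show y = 0 from Ext.eq_zero_of_projective y, Ext.comp_zero]

lemma exists_extension_of_subsingleton_ext_one {p : P →ₗ[S] C} (hp : Function.Surjective p)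
    (h : Subsingleton (Ext (ModuleCat.of S C) (ModuleCat.of S X) 1)) (f : p.ker →ₗ[S] X) :
    ∃ g : P →ₗ[S] X, ∀ x : p.ker, g x = f x := by
  have hS := LinearMap.shortExact_shortComplexKer hp
  obtain ⟨y, hy⟩ := Ext.contravariant_sequence_exact₁ hS (ModuleCat.of S X)
    (Ext.mk₀ (ModuleCat.ofHom f)) (add_zero 1) (h.elim _ _)
  obtain ⟨g, rfl⟩ := (Ext.mk₀_bijective _ _).2 y
  rw [Ext.mk₀_comp_mk₀] at hy
  have hg := (Ext.mk₀_bijective _ _).1 hy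
  exact ⟨g.hom, fun x => congrArg (fun t => t.hom x) hg⟩

end Ext

/-! ### Minimal free covers over a local ring -/

/-- Minimality of the cover is the condition that its kernel has all coordinates in the maximal
ideal. -/
lemma exists_minimal_free_cover (S : Type*) [CommRing S] [IsLocalRing S] (M : Type*)
    [AddCommGroup M] [Module S M] [Module.Finite S M] :
    ∃ (n : ℕ) (p : (Fin n → S) →ₗ[S] M), Function.Surjective p ∧
      ∀ v, p v = 0 → ∀ c, v c ∈ maximalIdeal S := by
  classical
  have hex := Module.Finite.exists_fin' S M
  obtain ⟨p, hp⟩ := Nat.find_spec hex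
  refine ⟨_, p, hp, fun v hv c => ?_⟩
  by_contra hc
  rw [mem_maximalIdeal, mem_nonunits_iff, not_not] at hc
  obtain ⟨u, hu⟩ := hc
  obtain ⟨m, hm⟩ : ∃ m, Nat.find hex = m + 1 := Nat.exists_eq_succ_of_ne_zero (by
    have := c.2
    lia)
  -- A relation with a unit coefficient makes one generator redundant.
  refine Nat.find_min hex (m := m) (by lia) ?_
  generalize Nat.find hex = n at *
  subst hm
  refine ⟨p ∘ₗ Function.ExtendByZero.linearMap S c.succAbove, fun x => ?_⟩
  obtain ⟨w, rfl⟩ := hp x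
  refine ⟨fun j => (w - (w c * ↑u⁻¹) • v) (c.succAbove j), ?_⟩
  have hw : p w = p (w - (w c * ↑u⁻¹) • v) := by simp [hv]
  rw [hw, LinearMap.comp_apply]
  congr 1
  funext j
  rcases Fin.eq_self_or_eq_succAbove c j with rfl | ⟨i, rfl⟩
  · simp only [Function.ExtendByZero.linearMap_apply]
    rw [Function.extend_apply' _ _ _ (by rintro ⟨i, hi⟩; exact Fin.succAbove_ne _ _ hi)]
    simp [← hu, mul_assoc]
  · simp only [Function.ExtendByZero.linearMap_apply]
    rw [Fin.succAbove_right_injective.extend_apply]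

/-! ### Local rings whose residue field is a direct summand of the maximal ideal -/

section Summand

variable {S : Type u} [CommRing S] {k : Type u} [AddCommGroup k] [Module S k]
  {π : S →ₗ[S] k} {ι : k →ₗ[S] π.ker} {ρ : π.ker →ₗ[S] k}
  {M : Type u} [AddCommGroup M] [Module S M]

/-- `π.ker` is a first syzygy of `k`, and `k` is a direct summand of it, so vanishing of
`Ext(k, M)` in some positive degree descends to all smaller positive degrees. -/
lemma subsingleton_ext_one (hπ : Function.Surjective π) (hρ : ρ ∘ₗ ι = LinearMap.id) (j : ℕ)
    (h : Subsingleton (Ext (ModuleCat.of S k) (ModuleCat.of S M) (j + 1))) :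
    Subsingleton (Ext (ModuleCat.of S k) (ModuleCat.of S M) 1) := by
  induction j with
  | zero => exact h
  | succ j ih => exact ih (subsingleton_ext_of_retract_left ι ρ hρ (subsingleton_ext_ker hπ h))

variable [IsLocalRing S]

lemma smul_eq_zero_of_mem (hπ : Function.Surjective π) (hker : π.ker = maximalIdeal S) {s : S}
    (hs : s ∈ maximalIdeal S) (x : k) : s • x = 0 := by
  obtain ⟨t, rfl⟩ := hπ x
  rw [← map_smul, ← LinearMap.mem_ker, hker, smul_eq_mul]
  exact Ideal.mul_mem_right _ _ hs

lemma mul_coe_eq_zero_of_mem (hπ : Function.Surjective π) (hker : π.ker = maximalIdeal S) {s : S}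
    (hs : s ∈ maximalIdeal S) (x : k) : s * (ι x : S) = 0 := by
  have h := congrArg ι (smul_eq_zero_of_mem hπ hker hs x)
  rw [map_smul, map_zero] at h
  simpa using congrArg Subtype.val h

/-- Let `N` be a nonzero submodule of `𝔫 Sⁿ`, such as the first syzygy of a module that is not free.
Then `k` is a direct summand of the first syzygy of `N`: embed it by `ι` in one coordinate of a
minimal free cover of `N`, and project back by `ρ`. -/
lemma subsingleton_ext_residue [IsNoetherianRing S] (hπ : Function.Surjective π)
    (hker : π.ker = maximalIdeal S) (hρ : ρ ∘ₗ ι = LinearMap.id) {n : ℕ}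
    {N : Submodule S (Fin n → S)} (hN : N ≠ ⊥) (hmin : ∀ v ∈ N, ∀ c, v c ∈ maximalIdeal S) {j : ℕ}
    (h : Subsingleton (Ext (ModuleCat.of S N) (ModuleCat.of S M) (j + 2))) :
    Subsingleton (Ext (ModuleCat.of S k) (ModuleCat.of S M) (j + 1)) := by
  obtain ⟨b, p, hp, hpmin⟩ := exists_minimal_free_cover S N
  have hb : b ≠ 0 := by
    rintro rfl
    refine hN ((Submodule.eq_bot_iff _).2 fun v hv => ?_)
    obtain ⟨w, hw⟩ := hp ⟨v, hv⟩
    rw [Subsingleton.elim w 0, map_zero] at hw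
    exact congrArg Subtype.val hw.symm
  let c : Fin b := ⟨0, Nat.pos_of_ne_zero hb⟩
  let i : k →ₗ[S] p.ker := LinearMap.codRestrict p.ker
    (LinearMap.single S (fun _ : Fin b => S) c ∘ₗ π.ker.subtype ∘ₗ ι) fun x => by
      have h1 : LinearMap.single S (fun _ : Fin b => S) c (ι x : S)
          = (ι x : S) • Pi.single c 1 := by
        rw [LinearMap.single_apply, ← Pi.single_smul, smul_eq_mul, mul_one]
      rw [LinearMap.mem_ker]
      change p (LinearMap.single S (fun _ : Fin b => S) c (ι x : S)) = 0
      rw [h1, map_smul]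
      ext a
      change (ι x : S) * (p (Pi.single c 1) : Fin n → S) a = 0
      rw [mul_comm]
      exact mul_coe_eq_zero_of_mem hπ hker (hmin _ (p (Pi.single c 1)).2 a) x
  let q : p.ker →ₗ[S] π.ker := LinearMap.codRestrict π.ker
    (LinearMap.proj c ∘ₗ p.ker.subtype) fun v => by
      rw [hker]
      exact hpmin _ v.2 c
  refine subsingleton_ext_of_retract_left i (ρ ∘ₗ q) ?_ (subsingleton_ext_ker hp h)
  have hq : q ∘ₗ i = ι := by
    ext x
    simp [q, i]
  rw [LinearMap.comp_assoc, hq, hρ]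

/-- If maps from the maximal ideal to `S` extend to `S`, the maximal ideal is generated by
`e = ι (π 1)`: the projection onto `S e` is then multiplication by some element of `S`, which is a
unit because it fixes `e`, so the projection is injective. -/
lemma ker_le_range_of_extends (hπ : Function.Surjective π) (hker : π.ker = maximalIdeal S)
    (hρ : ρ ∘ₗ ι = LinearMap.id)
    (h : ∀ f : π.ker →ₗ[S] S, ∃ g : S →ₗ[S] S, ∀ x : π.ker, g x = f x) {s : S}
    (hs : s ∈ maximalIdeal S) : ∃ t, s = t * (ι (π 1) : S) := by
  obtain ⟨g, hg⟩ := h (π.ker.subtype ∘ₗ ι ∘ₗ ρ)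
  have hρι (x : k) : ρ (ι x) = x := LinearMap.congr_fun hρ x
  have hg' (x : π.ker) : (x : S) * g 1 = (ι (ρ x) : S) := by
    rw [← smul_eq_mul, ← map_smul, smul_eq_mul, mul_one]
    exact hg x
  have hu : IsUnit (g 1) := by
    by_contra hu
    have h1 := hg' (ι (π 1))
    rw [mul_comm, mul_coe_eq_zero_of_mem hπ hker ((mem_maximalIdeal _).2 hu), hρι] at h1
    have h2 : ι (π 1) = 0 := Subtype.ext h1.symm
    have h3 : (1 : S) ∈ π.ker := by
      rw [LinearMap.mem_ker, ← hρι (π 1), h2, map_zero]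
    rw [hker] at h3
    exact (mem_maximalIdeal _).1 h3 isUnit_one
  obtain ⟨u, hu⟩ := hu
  obtain ⟨t, ht⟩ := hπ (ρ ⟨s, hker ▸ hs⟩)
  refine ⟨↑u⁻¹ * t, ?_⟩
  have h4 : (ι (ρ ⟨s, hker ▸ hs⟩) : S) = t * (ι (π 1) : S) := by
    rw [← ht, show π t = t • π 1 by rw [← map_smul, smul_eq_mul, mul_one], map_smul]
    rfl
  rw [mul_assoc, ← h4, ← hg' ⟨s, hker ▸ hs⟩, ← hu, mul_left_comm, Units.inv_mul, mul_one]

/-- Here the maximal ideal is generated by `e = ι (π 1)`. If `v = e w` is in the kernel of a minimal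
free cover, then `e` kills the image of `w`, which therefore lies in `e M`; by minimality the
coordinates of `w` are in the maximal ideal, so `v = e w = 0`. -/
lemma injective_of_extends (hπ : Function.Surjective π) (hker : π.ker = maximalIdeal S)
    (hρ : ρ ∘ₗ ι = LinearMap.id)
    (hgen : ∀ s ∈ maximalIdeal S, ∃ t, s = t * (ι (π 1) : S))
    (h : ∀ f : π.ker →ₗ[S] M, ∃ g : S →ₗ[S] M, ∀ x : π.ker, g x = f x) {n : ℕ}
    {p : (Fin n → S) →ₗ[S] M} (hp : Function.Surjective p)
    (hmin : ∀ v, p v = 0 → ∀ c, v c ∈ maximalIdeal S) : p.ker = ⊥ := by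
  have hρι (x : k) : ρ (ι x) = x := LinearMap.congr_fun hρ x
  set e : S := (ι (π 1) : S) with he
  have hmem : e ∈ maximalIdeal S := hker ▸ (ι (π 1)).2
  -- The elements of `M` killed by `e` are the multiples of `e`.
  have hsoc (m : M) (hm : e • m = 0) : ∃ x : M, m = e • x := by
    have hle : π.ker ≤ (LinearMap.toSpanSingleton S M m).ker := fun s hs => by
      obtain ⟨t, rfl⟩ := hgen s (hker ▸ hs)
      rw [LinearMap.mem_ker, LinearMap.toSpanSingleton_apply, mul_smul, hm, smul_zero]
    let l : k →ₗ[S] M := π.ker.liftQ _ hle ∘ₗ (π.quotKerEquivOfSurjective hπ).symm.toLinearMap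
    have hl : l (π 1) = m := by
      have h1 : (π.quotKerEquivOfSurjective hπ).symm (π 1) = π.ker.mkQ 1 := by
        rw [LinearEquiv.symm_apply_eq]
        rfl
      simp only [l, LinearMap.comp_apply, LinearEquiv.coe_coe, h1, Submodule.mkQ_apply,
        Submodule.liftQ_apply, LinearMap.toSpanSingleton_apply, one_smul]
    obtain ⟨g, hg⟩ := h (l ∘ₗ ρ)
    refine ⟨g 1, ?_⟩
    rw [← map_smul, smul_eq_mul, mul_one, he, hg, LinearMap.comp_apply, hρι, hl]
  refine (Submodule.eq_bot_iff _).2 fun v hv => ?_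
  choose w hw using fun c => hgen _ (hmin v hv c)
  have hvw : v = e • w := by
    funext c
    rw [hw c, Pi.smul_apply, smul_eq_mul, mul_comm]
  obtain ⟨x, hx⟩ := hsoc (p w) (by rw [← map_smul, ← hvw]; exact hv)
  obtain ⟨y, rfl⟩ := hp x
  have hwy := hmin (w - e • y) (by rw [map_sub, map_smul, hx, sub_self])
  funext c
  have hwc : w c ∈ maximalIdeal S := by
    have := Ideal.add_mem _ (hwy c) (Ideal.mul_mem_right (y c) _ hmem)
    simpa using this
  rw [hw c]
  exact mul_coe_eq_zero_of_mem hπ hker hwc _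

theorem free_of_subsingleton_ext [IsNoetherianRing S] [Module.Finite S M]
    (hπ : Function.Surjective π) (hker : π.ker = maximalIdeal S) (hρ : ρ ∘ₗ ι = LinearMap.id)
    (j : ℕ) (hM : Subsingleton (Ext (ModuleCat.of S M) (ModuleCat.of S M) (j + 3)))
    (hS : Subsingleton (Ext (ModuleCat.of S M) (ModuleCat.of S S) (j + 3))) :
    Module.Free S M := by
  obtain ⟨n, p, hp, hmin⟩ := exists_minimal_free_cover S M
  have hbot : p.ker = ⊥ := by
    by_contra hne
    have hMk := subsingleton_ext_one hπ hρ j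
      (subsingleton_ext_residue hπ hker hρ hne hmin (subsingleton_ext_ker hp hM))
    have hSk := subsingleton_ext_one hπ hρ j
      (subsingleton_ext_residue hπ hker hρ hne hmin (subsingleton_ext_ker hp hS))
    exact hne (injective_of_extends hπ hker hρ
      (fun s hs => ker_le_range_of_extends hπ hker hρ
        (exists_extension_of_subsingleton_ext_one hπ hSk) hs)
      (exists_extension_of_subsingleton_ext_one hπ hMk) hp hmin)
  exact Module.Free.of_equiv (LinearEquiv.ofBijective p ⟨LinearMap.ker_eq_bot.1 hbot, hp⟩)

end Summand

/-! ### The idealization of the residue field -/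

namespace ResidueIdealization

open TrivSqZeroExt

variable (R : Type u) [CommRing R] [IsLocalRing R]

instance isLocalRing : IsLocalRing (ResidueIdealization R) :=
  have : IsLocalHom (fstHom R R (ResidueField R)).toRingHom :=
    ⟨fun _ h => isUnit_iff_isUnit_fst.2 h⟩
  RingHom.domain_isLocalRing (fstHom R R (ResidueField R)).toRingHom

instance isNoetherianRing [IsNoetherianRing R] : IsNoetherianRing (ResidueIdealization R) :=
  have : IsNoetherian R (ResidueIdealization R) :=
    inferInstanceAs (IsNoetherian R (R × ResidueField R))
  isNoetherian_of_tower R this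

variable {R}

lemma mem_maximalIdeal_iff {s : ResidueIdealization R} :
    s ∈ maximalIdeal (ResidueIdealization R) ↔ s.fst ∈ maximalIdeal R := by
  rw [mem_maximalIdeal, mem_maximalIdeal, mem_nonunits_iff, mem_nonunits_iff,
    isUnit_iff_isUnit_fst]

variable (R) in
/-- Multiplication by `(0, 1)`, as a map from `R ⋉ k` onto its image, which is a copy of `k`. -/
noncomputable def toSocle : ResidueIdealization R →ₗ[ResidueIdealization R]
    (LinearMap.toSpanSingleton (ResidueIdealization R) (ResidueIdealization R)
      (inr (1 : ResidueField R))).range :=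
  (LinearMap.toSpanSingleton (ResidueIdealization R) (ResidueIdealization R)
    (inr (1 : ResidueField R))).rangeRestrict

lemma mul_inr_one (s : ResidueIdealization R) :
    s * inr (1 : ResidueField R) = inr (residue R s.fst) := by
  ext
  · simp
  · simp [Algebra.smul_def]

lemma ker_toSocle : (toSocle R).ker = maximalIdeal (ResidueIdealization R) := by
  ext s
  rw [toSocle, LinearMap.ker_rangeRestrict, LinearMap.mem_ker, LinearMap.toSpanSingleton_apply,
    smul_eq_mul, mul_inr_one, mem_maximalIdeal_iff, ← residue_eq_zero_iff]
  exact inr_injective.eq_iff' (inr_zero R)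

lemma inr_mem_range (a : ResidueField R) : (inr a : ResidueIdealization R) ∈
    (LinearMap.toSpanSingleton (ResidueIdealization R) (ResidueIdealization R)
      (inr (1 : ResidueField R))).range := by
  obtain ⟨r, rfl⟩ := residue_surjective a
  exact ⟨inl r, by rw [LinearMap.toSpanSingleton_apply, smul_eq_mul, mul_inr_one, fst_inl]⟩

variable (R) in
/-- The inclusion of the copy `{(0, a)}` of `k` into the maximal ideal. -/
noncomputable def socleToKer : (LinearMap.toSpanSingleton (ResidueIdealization R)
      (ResidueIdealization R) (inr (1 : ResidueField R))).range →ₗ[ResidueIdealization R]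
    (toSocle R).ker :=
  Submodule.inclusion (by
    rintro _ ⟨s, rfl⟩
    rw [ker_toSocle, mem_maximalIdeal_iff, LinearMap.toSpanSingleton_apply, smul_eq_mul,
      mul_inr_one, fst_inr]
    exact zero_mem _)

variable (R) in
/-- The projection `(r, a) ↦ (0, a)`. It is linear on the maximal ideal only: in
`(r, a) (s, b) = (r s, r b + s a)` the term `s a` vanishes for `s` in the maximal ideal. -/
noncomputable def kerToSocle : (toSocle R).ker →ₗ[ResidueIdealization R]
    (LinearMap.toSpanSingleton (ResidueIdealization R) (ResidueIdealization R)
      (inr (1 : ResidueField R))).range where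
  toFun x := ⟨inr (x : ResidueIdealization R).snd, inr_mem_range _⟩
  map_add' x y := Subtype.ext (by simp)
  map_smul' s x := Subtype.ext (by
    have hx : (x : ResidueIdealization R).fst ∈ maximalIdeal R :=
      mem_maximalIdeal_iff.1 (ker_toSocle (R := R) ▸ x.2)
    have h0 : (x : ResidueIdealization R).fst • s.snd = 0 := by
      rw [Algebra.smul_def, show algebraMap R (ResidueField R) _ = 0 from
        (residue_eq_zero_iff _).2 hx, zero_mul]
    ext
    · simp
    · simp [h0])

lemma kerToSocle_comp_socleToKer : kerToSocle R ∘ₗ socleToKer R = LinearMap.id := by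
  ext x : 1
  obtain ⟨_, s, rfl⟩ := x
  apply Subtype.ext
  simp [kerToSocle, socleToKer, mul_inr_one]

end ResidueIdealization

theorem theorem3p5 (R : Type u) [CommRing R] [IsLocalRing R] [IsNoetherianRing R]
    (M : Type u) [AddCommGroup M] [Module (ResidueIdealization R) M]
    [Module.Finite (ResidueIdealization R) M]
    (i : ℕ) (hi : 3 ≤ i)
    (hExt : Subsingleton (CategoryTheory.Abelian.Ext
      (ModuleCat.of (ResidueIdealization R) M)
      (ModuleCat.of (ResidueIdealization R) (M × ResidueIdealization R)) i)) :
    Module.Free (ResidueIdealization R) M := by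
  obtain ⟨j, rfl⟩ := Nat.exists_eq_add_of_le' hi
  exact free_of_subsingleton_ext (LinearMap.surjective_rangeRestrict _)
    ResidueIdealization.ker_toSocle ResidueIdealization.kerToSocle_comp_socleToKer j
    (subsingleton_ext_of_retract_right (LinearMap.inl _ _ _) (LinearMap.fst _ _ _)
      (LinearMap.fst_comp_inl ..) hExt)
    (subsingleton_ext_of_retract_right (LinearMap.inr _ _ _) (LinearMap.snd _ _ _)
      (LinearMap.snd_comp_inr ..) hExt)
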